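/- Write $(q)_k=q(q+1)\cdots(q+k-1)$ and $${}_rF_s\!\left(\begin{matrix}u_1,\dots,u_r\\ l_1,\dots,l_s\end{matrix};z\right)=\sum_{k\ge0}\frac{(u_1)_k\cdots(u_r)_k}{(l_1)_k\cdots(l_s)_k\,k!}\,z^k .$$ Let the Wilson polynomials and the continuous Hahn polynomials be given by $$W_n(x^2;a,b,c,d)=(a+b)_n(a+c)_n(a+d)_n\;{}_4F_3\!\left(\begin{matrix}-n,\;n+a+b+c+d-1,\;a+ix,\;a-ix\\ a+b,\;a+c,\;a+d\end{matrix};1\right),$$ $$p_n(x;a,b,c,d)=\frac{i^n(a+c)_n(a+d)_n}{n!}\;{}_3F_2\!\left(\begin{matrix}-n,\;n+a+b+c+d-1,\;a+ix\\ a+c,\;a+d\end{matrix};1\right),$$ where the prefactors are multiplied into the terminating sums by means of $(q)_n/(q)_k=(q+k)_{n-k}$, so that both are polynomials, in $x^2$ and in $x$ respectively, for all complex parameters. (1) Let $a,b\in\mathbb C$ with $a,b$ both real or $b=\overline a$, and let $n\ge0$ be an integer. If $p_{2n}(ia;a,b,a,b)\ne0$, then $W_n(-a^2;a,b,\tfrac12,0)\ne0$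 and for all $x\in\mathbb C$ $$\frac{p_{2n}(x;a,b,a,b)}{p_{2n}(ia;a,b,a,b)}=\frac{W_n(x^2;a,b,\frac12,0)}{W_n(-a^2;a,b,\frac12,0)} .$$ If $p_{2n+1}(ia;a,b,a,b)\ne0$, then $ia\,W_n(-a^2;a,b,\tfrac12,1)\neq0$ and for all $x\in\mathbb C$ $$\frac{p_{2n+1}(x;a,b,a,b)}{p_{2n+1}(ia;a,b,a,b)}=\frac{x\,W_n(x^2;a,b,\frac12,1)}{ia\,W_n(-a^2;a,b,\frac12,1)} .$$ (2) Let $a,b,c,d\in\mathbb C$. Then $${}_3F_2\!\left(\begin{matrix}2a,\;2b+1,\;c\\ a+b+1,\;c+d\end{matrix};1\right)={}_4F_3\!\left(\begin{matrix}a,\;b+\frac12,\;c,\;d\\ a+b+1,\;\frac12(c+d),\;\frac12(c+d+1)\end{matrix};1\right)$$ whenever both sides terminate through corresponding upper parameters, that is, through $2a$ on the left and $a$ on the right, or through $2b+1$ on the left and $b+\frac12$ on the right, or through $c$ on both sides; and, if $c+d\ne0$, $${}_3F_2\!\left(\begin{matrix}2a,\;2b+1,\;c\\ a+b+1,\;c+d\end{matrix};1\right)=\frac{d-c}{d+c}\;{}_4F_3\!\left(\begin{matrix}a+\frac12,\;b+1,\;c,\;d\\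 a+b+1,\;\frac12(c+d)+1,\;\frac12(c+d+1)\end{matrix};1\right)$$ whenever both sides terminate through corresponding upper parameters, that is, through $2a$ on the left and $a+\frac12$ on the right, or through $2b+1$ on the left and $b+1$ on the right, or through $c$ on both sides. Here a series terminates through an upper parameter $p$ if $p=-N$ with an integer $N\ge0$ and $(l)_N\neq0$ for each lower parameter $l$; a term that is no longer reached because an upper parameter has become zero counts as zero. -/

import Mathlib

open Finset

/-- The Pochhammer symbol `(a)_k = a (a+1) ⋯ (a+k-1)`. -/
noncomputable def poch (a : ℂ) (k : ℕ) : ℂ := (ascPochhammer ℂ k).eval a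

/-- The generalized hypergeometric series with upper parameters `u`, lower parameters `l` and
argument `z`. -/
noncomputable def pFq (u l : List ℂ) (z : ℂ) : ℂ :=
  ∑' k : ℕ, (u.map fun p => poch p k).prod /
    ((l.map fun q => poch q k).prod * (k.factorial : ℂ)) * z ^ k

/-- The upper parameter `p` is a nonpositive integer `-N`, so that it terminates a hypergeometric
series after the term of index `N`, and for lower parameters `l` no denominator vanishes in the
terms of index at most `N`. -/
def TerminatesThrough (p : ℂ) (l : List ℂ) : Prop :=
  ∃ N : ℕ, p = -(N : ℂ) ∧ ∀ q ∈ l, poch q N ≠ 0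

/-- The continuous Hahn polynomial `p_n(x; a, b, c, d)`. The prefactor `(a+c)_n (a+d)_n` is
multiplied into the terminating `₃F₂`, using `(q)_n / (q)_k = (q+k)_{n-k}`, which gives the
polynomial for all complex parameters; see `contHahn_eq`. -/
noncomputable def contHahn (n : ℕ) (x a b c d : ℂ) : ℂ :=
  Complex.I ^ n / (n.factorial : ℂ) * ∑ k ∈ range (n + 1),
    poch (-(n : ℂ)) k * poch (n + a + b + c + d - 1) k * poch (a + Complex.I * x) k
      * (poch (a + c + k) (n - k) * poch (a + d + k) (n - k)) / (k.factorial : ℂ)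

/-- The Wilson polynomial `W_n(y; a, b, c, d)`, as a polynomial in `y`. Here
`∏_{j<k} ((a+j)² + y)` is `(a+ix)_k (a-ix)_k` for `y = x²`, and the prefactor
`(a+b)_n (a+c)_n (a+d)_n` is multiplied into the terminating `₄F₃`; see `wilson_eq`. -/
noncomputable def wilson (n : ℕ) (y a b c d : ℂ) : ℂ :=
  ∑ k ∈ range (n + 1),
    poch (-(n : ℂ)) k * poch (n + a + b + c + d - 1) k * (∏ j ∈ range k, ((a + j) ^ 2 + y))
      * (poch (a + b + k) (n - k) * poch (a + c + k) (n - k) * poch (a + d + k) (n - k))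
      / (k.factorial : ℂ)

theorem poch_split (q : ℂ) {k n : ℕ} (h : k ≤ n) :
    poch q n = poch q k * poch (q + k) (n - k) := by
  obtain ⟨m, rfl⟩ := Nat.exists_eq_add_of_le h
  simp [poch, ← ascPochhammer_mul]

theorem poch_neg_eq_zero {n k : ℕ} (h : n < k) : poch (-(n : ℂ)) k = 0 := by
  obtain ⟨m, rfl⟩ := Nat.exists_eq_add_of_lt h
  rw [poch_split (-(n : ℂ)) (show n + 1 ≤ n + m + 1 by omega)]
  simp [poch, ascPochhammer_succ_right]

theorem poch_mul_conj (a x : ℂ) (k : ℕ) :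
    poch (a + Complex.I * x) k * poch (a - Complex.I * x) k
      = ∏ j ∈ range k, ((a + j) ^ 2 + x ^ 2) := by
  induction k with
  | zero => simp [poch]
  | succ k ih =>
    rw [prod_range_succ, ← ih]
    simp only [poch, ascPochhammer_succ_right, Polynomial.eval_mul, Polynomial.eval_add,
      Polynomial.eval_X, Polynomial.eval_natCast]
    linear_combination (-(Polynomial.eval (a + Complex.I * x) (ascPochhammer ℂ k)) *
      (Polynomial.eval (a - Complex.I * x) (ascPochhammer ℂ k)) * x ^ 2) * Complex.I_sq

/-- The usual hypergeometric formula for the continuous Hahn polynomials. -/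
theorem contHahn_eq (n : ℕ) (x a b c d : ℂ) (hc : poch (a + c) n ≠ 0) (hd : poch (a + d) n ≠ 0) :
    contHahn n x a b c d = Complex.I ^ n * poch (a + c) n * poch (a + d) n / (n.factorial : ℂ) *
      pFq [-(n : ℂ), n + a + b + c + d - 1, a + Complex.I * x] [a + c, a + d] 1 := by
  unfold contHahn pFq
  rw [tsum_eq_sum (s := range (n + 1)), mul_sum, mul_sum]
  · refine sum_congr rfl fun k hk => ?_
    have hk' : k ≤ n := by simpa [Nat.lt_succ_iff] using hk
    have h1 := poch_split (a + c) hk'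
    have h2 := poch_split (a + d) hk'
    have h3 : poch (a + c) k ≠ 0 := fun h => hc (by rw [h1, h, zero_mul])
    have h4 : poch (a + d) k ≠ 0 := fun h => hd (by rw [h2, h, zero_mul])
    have h5 : (k.factorial : ℂ) ≠ 0 := by exact_mod_cast k.factorial_ne_zero
    have h6 : (n.factorial : ℂ) ≠ 0 := by exact_mod_cast n.factorial_ne_zero
    rw [h1, h2]
    simp only [List.map_cons, List.map_nil, List.prod_cons, List.prod_nil, one_pow, mul_one]
    field_simp
  · intro k hk
    simp [poch_neg_eq_zero (show n < k by simpa using hk)]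

/-- The usual hypergeometric formula for the Wilson polynomials. -/
theorem wilson_eq (n : ℕ) (x a b c d : ℂ) (hb : poch (a + b) n ≠ 0) (hc : poch (a + c) n ≠ 0)
    (hd : poch (a + d) n ≠ 0) :
    wilson n (x ^ 2) a b c d = poch (a + b) n * poch (a + c) n * poch (a + d) n *
      pFq [-(n : ℂ), n + a + b + c + d - 1, a + Complex.I * x, a - Complex.I * x]
        [a + b, a + c, a + d] 1 := by
  unfold wilson pFq
  rw [tsum_eq_sum (s := range (n + 1)), mul_sum]
  · refine sum_congr rfl fun k hk => ?_
    have hk' : k ≤ n := by simpa [Nat.lt_succ_iff] using hk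
    have h0 := poch_split (a + b) hk'
    have h1 := poch_split (a + c) hk'
    have h2 := poch_split (a + d) hk'
    have h7 : poch (a + b) k ≠ 0 := fun h => hb (by rw [h0, h, zero_mul])
    have h3 : poch (a + c) k ≠ 0 := fun h => hc (by rw [h1, h, zero_mul])
    have h4 : poch (a + d) k ≠ 0 := fun h => hd (by rw [h2, h, zero_mul])
    have h5 : (k.factorial : ℂ) ≠ 0 := by exact_mod_cast k.factorial_ne_zero
    rw [h0, h1, h2, ← poch_mul_conj]
    simp only [List.map_cons, List.map_nil, List.prod_cons, List.prod_nil, one_pow, mul_one]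
    field_simp
  · intro k hk
    simp [poch_neg_eq_zero (show n < k by simpa using hk)]

/-! Part (2) comes from integrating two quadratic transformations of Gauss's series against a Beta
weight: `₂F₁(2a, 2b+1; a+b+1; X) = ₂F₁(a, b+1/2; a+b+1; 4X(1-X)) = (1-2X) ₂F₁(a+1/2, b+1; a+b+1;
4X(1-X))`. They are used only coefficientwise in `X`. Both right-hand sides satisfy the
hypergeometric equation of the left-hand side, hence its two-term coefficient recurrence, which
determines the coefficients as long as `(a+b+1)_m ≠ 0` (`hypergeometric_coeff_eq_sum`).

The Beta integral becomes the linear functional `X^m ↦ (c)_m / (c+d)_m`, which sends `X^i (1-X)^j`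
to `(c)_i (d)_j / (c+d)_{i+j}` (`sum_coeff_mul_beta`). It turns the left-hand series into the `₃F₂`
and, after duplication of `(c+d)_{2k}` or `(c+d)_{2k+1}`, the right-hand ones into the `₄F₃`s.
Termination makes every sum finite (`sum_hypergeometric_transform`).

Part (1) is part (2) with `c, d = a ± ix`, terminated by the degree. -/

/-! ### Pochhammer symbols. -/

theorem poch_zero_right (a : ℂ) : poch a 0 = 1 := by simp [poch]

theorem poch_succ (a : ℂ) (k : ℕ) : poch a (k + 1) = poch a k * (a + k) := by
  simp [poch, ascPochhammer_succ_right]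

theorem poch_succ_left (a : ℂ) (k : ℕ) : poch a (k + 1) = a * poch (a + 1) k := by
  rw [poch_split a (Nat.le_add_left 1 k)]
  simp [poch]

theorem poch_ne_zero_of_le {q : ℂ} {k n : ℕ} (h : k ≤ n) (hn : poch q n ≠ 0) : poch q k ≠ 0 :=
  fun h0 => hn (by rw [poch_split q h, h0, zero_mul])

/-- The factors of even and of odd index are collected separately. With `s = c + d` this produces
the two halved lower parameters, and the power of 4 cancels the one coming from `4X(1-X)`. -/
theorem poch_two_mul (s : ℂ) (k : ℕ) :
    poch s (2 * k) = 4 ^ k * (poch (s / 2) k * poch ((s + 1) / 2) k) := by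
  induction k with
  | zero => simp [poch_zero_right]
  | succ k ih =>
    rw [show 2 * (k + 1) = 2 * k + 1 + 1 by ring, poch_succ, poch_succ, ih, poch_succ, poch_succ]
    push_cast
    ring

theorem poch_two_mul_add_one (s : ℂ) (k : ℕ) :
    poch s (2 * k + 1) = s * (4 ^ k * (poch (s / 2 + 1) k * poch ((s + 1) / 2) k)) := by
  rw [poch_succ_left, poch_two_mul, mul_comm (poch ((s + 1) / 2) k)]
  congr 4
  ring

/-! ### Quadratic transformations of `₂F₁`, coefficientwise. -/

/-- The hypergeometric differential operator acts on coefficients by a two-term recurrence. -/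
theorem coeff_hypergeometric_operator (f : Polynomial ℂ) (s p q : ℂ) (m : ℕ) :
    (Polynomial.X * (1 - Polynomial.X) * f.derivative.derivative
      + (Polynomial.C s - Polynomial.C (p + q + 1) * Polynomial.X) * f.derivative
      - Polynomial.C (p * q) * f).coeff m
      = (m + 1) * (s + m) * f.coeff (m + 1) - (p + m) * (q + m) * f.coeff m := by
  have h : Polynomial.X * (1 - Polynomial.X) * f.derivative.derivative
      + (Polynomial.C s - Polynomial.C (p + q + 1) * Polynomial.X) * f.derivative
      - Polynomial.C (p * q) * f
      = Polynomial.X * f.derivative.derivative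
        - Polynomial.X * (Polynomial.X * f.derivative.derivative)
        + Polynomial.C s * f.derivative
        - Polynomial.C (p + q + 1) * (Polynomial.X * f.derivative)
        - Polynomial.C (p * q) * f := by ring
  rw [h]
  rcases m with _ | _ | m
  · simp [Polynomial.coeff_derivative]
  · simp only [Polynomial.coeff_sub, Polynomial.coeff_add, Polynomial.coeff_C_mul,
      Polynomial.coeff_X_mul, Polynomial.coeff_X_mul_zero, Polynomial.coeff_derivative]
    push_cast
    ring
  · simp only [Polynomial.coeff_sub, Polynomial.coeff_add, Polynomial.coeff_C_mul,
      Polynomial.coeff_X_mul, Polynomial.coeff_derivative]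
    push_cast
    ring

theorem derivative_X_mul_one_sub_X_pow (k : ℕ) :
    Polynomial.derivative ((Polynomial.X * (1 - Polynomial.X) : Polynomial ℂ) ^ (k + 1))
      = Polynomial.C ((k : ℂ) + 1) * (Polynomial.X * (1 - Polynomial.X)) ^ k
        * (1 - 2 * Polynomial.X) := by
  rw [Polynomial.derivative_pow]
  simp only [Polynomial.derivative_mul, Polynomial.derivative_X, Polynomial.derivative_sub,
    Polynomial.derivative_one, Nat.add_sub_cancel]
  push_cast
  ring

/-- The hypergeometric operator with parameters `2a, 2b+1; a+b+1` acts on the powers of `X (1 - X)`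
as the one with parameters `a, b+1/2; a+b+1` acts on powers of the variable `4 X (1 - X)`. -/
theorem coeff_recurrence_pow (a b : ℂ) (k m : ℕ) :
    ((m : ℂ) + 1) * (a + b + 1 + m)
        * ((Polynomial.X * (1 - Polynomial.X) : Polynomial ℂ) ^ k).coeff (m + 1)
      - (2 * a + m) * (2 * b + 1 + m)
        * ((Polynomial.X * (1 - Polynomial.X) : Polynomial ℂ) ^ k).coeff m
      = k * (a + b + 1 + k - 1)
        * ((Polynomial.X * (1 - Polynomial.X) : Polynomial ℂ) ^ (k - 1)).coeff m
      - 4 * (a + k) * (b + 1 / 2 + k)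
        * ((Polynomial.X * (1 - Polynomial.X) : Polynomial ℂ) ^ k).coeff m := by
  -- With `Y = X(1-X)` one has `Y'^2 = 1 - 4Y` and `Y'' = -2`. The first-order coefficient is
  -- `(a+b+1) Y'`, so the operator maps `Y^k` to a combination of `Y^(k-1)` and `Y^k`.
  rw [← coeff_hypergeometric_operator, show 4 * (a + k) * (b + 1 / 2 + k)
    = (2 * a + 2 * k) * (2 * b + 1 + 2 * k) by ring]
  simp only [← Polynomial.coeff_C_mul, ← Polynomial.coeff_sub]
  congr 1
  -- Two derivatives lower the exponent by up to 2; separating `k = 0` and `k = 1` avoids truncated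
  -- subtraction.
  rcases k with _ | _ | k
  · simp only [pow_zero, mul_one, Polynomial.derivative_one, Polynomial.derivative_zero, map_mul,
      map_add, map_sub, map_natCast, map_ofNat, map_one]
    push_cast
    ring
  · simp only [zero_add, pow_one, Polynomial.derivative_mul, Polynomial.derivative_X,
      Polynomial.derivative_one, Polynomial.derivative_zero, map_mul, map_add, map_sub, map_natCast,
      map_ofNat, map_one]
    push_cast
    ring
  · simp only [zero_add, mul_one, Polynomial.derivative_mul, Polynomial.derivative_X,
      Polynomial.derivative_one, Polynomial.derivative_ofNat, Polynomial.derivative_natCast,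
      derivative_X_mul_one_sub_X_pow, map_mul, map_add, map_sub, map_natCast, map_ofNat, map_one]
    simp only [Nat.add_sub_cancel]
    push_cast
    ring

/-- The analogue of `coeff_recurrence_pow` for the products `(1 - 2 X) (X (1 - X)) ^ k` and the
parameters `a+1/2, b+1; a+b+1`. -/
theorem coeff_recurrence_mul_pow (a b : ℂ) (k m : ℕ) :
    ((m : ℂ) + 1) * (a + b + 1 + m) * ((1 - 2 * Polynomial.X)
        * (Polynomial.X * (1 - Polynomial.X) : Polynomial ℂ) ^ k).coeff (m + 1)
      - (2 * a + m) * (2 * b + 1 + m) * ((1 - 2 * Polynomial.X)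
        * (Polynomial.X * (1 - Polynomial.X) : Polynomial ℂ) ^ k).coeff m
      = k * (a + b + 1 + k - 1) * ((1 - 2 * Polynomial.X)
        * (Polynomial.X * (1 - Polynomial.X) : Polynomial ℂ) ^ (k - 1)).coeff m
      - 4 * (a + 1 / 2 + k) * (b + 1 + k) * ((1 - 2 * Polynomial.X)
        * (Polynomial.X * (1 - Polynomial.X) : Polynomial ℂ) ^ k).coeff m := by
  rw [← coeff_hypergeometric_operator, show 4 * (a + 1 / 2 + k) * (b + 1 + k)
    = (2 * a + 1 + 2 * k) * (2 * b + 2 + 2 * k) by ring]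
  simp only [← Polynomial.coeff_C_mul, ← Polynomial.coeff_sub]
  congr 1
  rcases k with _ | _ | k
  · simp only [pow_zero, mul_one, Polynomial.derivative_mul, Polynomial.derivative_X,
      Polynomial.derivative_one, Polynomial.derivative_zero, Polynomial.derivative_ofNat, map_mul,
      map_add, map_sub, map_natCast, map_ofNat, map_one]
    push_cast
    ring
  · simp only [zero_add, pow_one, mul_one, Polynomial.derivative_mul, Polynomial.derivative_X,
      Polynomial.derivative_one, Polynomial.derivative_zero, Polynomial.derivative_ofNat, map_mul,
      map_add, map_sub, map_natCast, map_ofNat, map_one]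
    push_cast
    ring
  · simp only [zero_add, mul_one, Polynomial.derivative_mul, Polynomial.derivative_X,
      Polynomial.derivative_one, Polynomial.derivative_zero, Polynomial.derivative_ofNat,
      Polynomial.derivative_natCast, derivative_X_mul_one_sub_X_pow, map_mul, map_add, map_sub,
      map_natCast, map_ofNat, map_one]
    simp only [Nat.add_sub_cancel]
    push_cast
    ring

/-- A family `P` of coefficient sequences intertwining two hypergeometric recurrences expresses
the coefficients of one series through those of the other. -/
theorem hypergeometric_coeff_eq_sum {p q s α β : ℂ} {P : ℕ → ℕ → ℂ}
    (hP : ∀ k m : ℕ, ((m : ℂ) + 1) * (s + m) * P k (m + 1) - (p + m) * (q + m) * P k m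
      = k * (s + k - 1) * P (k - 1) m - 4 * (α + k) * (β + k) * P k m)
    (hlt : ∀ k m, m < k → P k m = 0) (h0 : P 0 0 = 1) {m J : ℕ} (hJ : m ≤ J)
    (hs : poch s m ≠ 0) :
    poch p m * poch q m / (poch s m * (m.factorial : ℂ))
      = ∑ k ∈ range (J + 1),
        4 ^ k * (poch α k * poch β k) / (poch s k * (k.factorial : ℂ)) * P k m := by
  suffices h : poch p m * poch q m / (poch s m * (m.factorial : ℂ))
      = ∑ k ∈ range (m + 1),
        4 ^ k * (poch α k * poch β k) / (poch s k * (k.factorial : ℂ)) * P k m by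
    rw [h]
    refine sum_subset (range_subset_range.2 (by omega)) fun k _ hk => ?_
    rw [hlt k m (by simpa using hk), mul_zero]
  clear hJ
  induction m with
  | zero => simp [poch_zero_right, h0]
  | succ m ih =>
    have hs' := poch_ne_zero_of_le (Nat.le_succ m) hs
    specialize ih hs'
    have hsm : s + m ≠ 0 := by
      rw [poch_succ] at hs; exact right_ne_zero_of_mul hs
    have hm : (m : ℂ) + 1 ≠ 0 := Nat.cast_add_one_ne_zero m
    set g : ℕ → ℂ := fun k => 4 ^ k * (poch α k * poch β k) / (poch s k * (k.factorial : ℂ))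
      with hg
    have hstep : ∀ k ≤ m, g (k + 1) * ((k + 1) * (s + k)) = 4 * (α + k) * (β + k) * g k := by
      intro k hk
      have h1 : poch s (k + 1) ≠ 0 := poch_ne_zero_of_le (by omega) hs
      rw [poch_succ] at h1
      have h2 := left_ne_zero_of_mul h1
      have h3 := right_ne_zero_of_mul h1
      have h4 : (k : ℂ) + 1 ≠ 0 := Nat.cast_add_one_ne_zero k
      have h5 : (k.factorial : ℂ) ≠ 0 := by exact_mod_cast k.factorial_ne_zero
      simp only [hg, poch_succ, Nat.factorial_succ, pow_succ]
      push_cast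
      field_simp
    -- By `hstep` the two sums differ by an index shift. The boundary terms vanish: `k = 0` by its
    -- factor `k`, and `k = m + 1` by triangularity of `P`. Hence, summed against `g`, the right
    -- side of `hP` is zero, leaving the recurrence in `m`.
    have htel : ∑ k ∈ range (m + 2), g k * (k * (s + k - 1) * P (k - 1) m)
        = ∑ k ∈ range (m + 2), g k * (4 * (α + k) * (β + k) * P k m) := by
      rw [sum_range_succ', sum_range_succ _ (m + 1), hlt (m + 1) m (by omega)]
      simp only [Nat.cast_zero, zero_mul, mul_zero, add_zero]
      refine sum_congr rfl fun k hk => ?_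
      have := hstep k (by simpa [Nat.lt_succ_iff] using hk)
      simp only [Nat.add_sub_cancel]
      push_cast
      linear_combination P k m * this
    have hsum : ∑ k ∈ range (m + 2), g k * ((m + 1) * (s + m) * P k (m + 1))
        = ∑ k ∈ range (m + 2), g k * ((p + m) * (q + m) * P k m) := by
      rw [← sub_eq_zero, ← sum_sub_distrib]
      rw [← sub_eq_zero, ← sum_sub_distrib] at htel
      rw [← htel]
      refine sum_congr rfl fun k _ => ?_
      linear_combination g k * hP k m
    have hih : ∑ k ∈ range (m + 2), g k * ((p + m) * (q + m) * P k m)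
        = (p + m) * (q + m) * (poch p m * poch q m / (poch s m * (m.factorial : ℂ))) := by
      rw [sum_range_succ _ (m + 1), hlt (m + 1) m (by omega), mul_zero, mul_zero, add_zero, ih,
        mul_sum]
      exact sum_congr rfl fun k _ => by ring
    have hf : (m.factorial : ℂ) ≠ 0 := by exact_mod_cast m.factorial_ne_zero
    have hl : ∑ k ∈ range (m + 2), g k * ((m + 1) * (s + m) * P k (m + 1))
        = (m + 1) * (s + m) * ∑ k ∈ range (m + 2), g k * P k (m + 1) := by
      rw [mul_sum]
      exact sum_congr rfl fun k _ => by ring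
    rw [hih, hl] at hsum
    apply mul_left_cancel₀ (mul_ne_zero hm hsm)
    rw [hsum]
    simp only [poch_succ, Nat.factorial_succ]
    push_cast
    field_simp

/-! ### Beta moments and summation against weights. -/

/-- The Beta moments of `X ^ i * (1 - X) ^ j`. -/
theorem sum_coeff_mul_beta {c d : ℂ} {T : ℕ} {i j : ℕ} (hT : i + j < T)
    (h : poch (c + d) (i + j) ≠ 0) :
    ∑ m ∈ range T, ((Polynomial.X ^ i * (1 - Polynomial.X) ^ j : Polynomial ℂ)).coeff m
        * (poch c m / poch (c + d) m)
      = poch c i * poch d j / poch (c + d) (i + j) := by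
  induction j generalizing i with
  | zero =>
    simp only [pow_zero, mul_one, Polynomial.coeff_X_pow, add_zero, poch_zero_right]
    simp only [ite_mul, one_mul, zero_mul, sum_ite_eq', mem_range]
    rw [if_pos (by omega)]
  | succ j ih =>
    -- Splitting off one factor `1 - X` reduces the claim to `d + j = (c + d + i + j) - (c + i)`.
    have h1 := ih (i := i) (by omega) (poch_ne_zero_of_le (by omega) h)
    have h2 := ih (i := i + 1) (by omega) (poch_ne_zero_of_le (by omega) h)
    have hpoly : (Polynomial.X ^ i * (1 - Polynomial.X) ^ (j + 1) : Polynomial ℂ)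
        = Polynomial.X ^ i * (1 - Polynomial.X) ^ j
          - Polynomial.X ^ (i + 1) * (1 - Polynomial.X) ^ j := by ring
    simp only [hpoly, Polynomial.coeff_sub, sub_mul, sum_sub_distrib]
    rw [h1, h2, show i + 1 + j = i + j + 1 by ring, ← add_assoc]
    rw [← add_assoc] at h
    simp only [poch_succ] at h ⊢
    have h3 := left_ne_zero_of_mul h
    have h4 := right_ne_zero_of_mul h
    field_simp
    push_cast
    ring

/-- An exchange of two finite sums. The terms with `k > K` drop out either because `α` terminates
the inner series, or because the weight vanishes from index `k` on while `P k m` vanishes below it.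
The lower parameter `s` matters only where the weight is nonzero. -/
theorem sum_hypergeometric_transform {p q s α β : ℂ} {P : ℕ → ℕ → ℂ} {w : ℕ → ℂ} {T K : ℕ}
    (hP : ∀ k m : ℕ, ((m : ℂ) + 1) * (s + m) * P k (m + 1) - (p + m) * (q + m) * P k m
      = k * (s + k - 1) * P (k - 1) m - 4 * (α + k) * (β + k) * P k m)
    (hlt : ∀ k m, m < k → P k m = 0) (h0 : P 0 0 = 1) (hKT : K ≤ T)
    (hs : ∀ m ≤ T, w m ≠ 0 → poch s m ≠ 0)
    (hK : ∀ k, K < k → poch α k = 0 ∨ ∀ m, k ≤ m → w m = 0) :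
    ∑ m ∈ range (T + 1), poch p m * poch q m / (poch s m * (m.factorial : ℂ)) * w m
      = ∑ k ∈ range (K + 1), 4 ^ k * (poch α k * poch β k) / (poch s k * (k.factorial : ℂ))
        * ∑ m ∈ range (T + 1), P k m * w m := by
  have h1 : ∀ m ∈ range (T + 1), poch p m * poch q m / (poch s m * (m.factorial : ℂ)) * w m
      = ∑ k ∈ range (T + 1),
        4 ^ k * (poch α k * poch β k) / (poch s k * (k.factorial : ℂ)) * (P k m * w m) := by
    intro m hm
    have hm' : m ≤ T := by simpa [Nat.lt_succ_iff] using hm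
    by_cases hw : w m = 0
    · simp [hw]
    · rw [hypergeometric_coeff_eq_sum hP hlt h0 hm' (hs m hm' hw), sum_mul]
      exact sum_congr rfl fun k _ => by ring
  rw [sum_congr rfl h1, sum_comm]
  simp only [← mul_sum]
  refine (sum_subset (range_subset_range.2 (by omega)) fun k _ hk => ?_).symm
  rcases hK k (by simpa using hk) with h | h
  · simp [h]
  · rw [sum_eq_zero fun m _ => ?_, mul_zero]
    rcases lt_or_ge m k with hmk | hmk
    · rw [hlt k m hmk, zero_mul]
    · rw [h m hmk, mul_zero]

/-! ### Terminating `₃F₂ = ₄F₃` identities. -/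

theorem pFq_three_two_eq_sum {p q c s e : ℂ} {T : ℕ}
    (h : ∀ m, T < m → poch p m = 0 ∨ poch c m = 0) :
    pFq [p, q, c] [s, e] 1 = ∑ m ∈ range (T + 1),
      poch p m * poch q m / (poch s m * (m.factorial : ℂ)) * (poch c m / poch e m) := by
  unfold pFq
  simp only [List.map_cons, List.map_nil, List.prod_cons, List.prod_nil, one_pow, mul_one]
  rw [tsum_eq_sum (s := range (T + 1))]
  · refine sum_congr rfl fun m _ => ?_
    rw [div_mul_div_comm]
    congr 1 <;> ring
  · intro m hm
    rcases h m (by simpa using hm) with h | h <;> simp [h]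

theorem pFq_four_three_eq_sum {α β c d s e f : ℂ} {K : ℕ}
    (h : ∀ k, K < k → poch α k = 0 ∨ poch c k = 0) :
    pFq [α, β, c, d] [s, e, f] 1 = ∑ k ∈ range (K + 1),
      poch α k * poch β k / (poch s k * (k.factorial : ℂ))
        * (poch c k * poch d k / (poch e k * poch f k)) := by
  unfold pFq
  simp only [List.map_cons, List.map_nil, List.prod_cons, List.prod_nil, one_pow, mul_one]
  rw [tsum_eq_sum (s := range (K + 1))]
  · refine sum_congr rfl fun m _ => ?_
    rw [div_mul_div_comm]
    congr 1 <;> ring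
  · intro k hk
    rcases h k (by simpa using hk) with h | h <;> simp [h]

theorem coeff_mul_X_mul_pow_of_lt (f g : Polynomial ℂ) {k m : ℕ} (h : m < k) :
    (f * (Polynomial.X * g) ^ k).coeff m = 0 := by
  rw [mul_pow, mul_left_comm, Polynomial.coeff_X_pow_mul', if_neg (by omega)]

/-- The quadratic transformation of a terminating `₃F₂` at `1` without a linear prefactor. -/
theorem pFq_quadratic {a b c d : ℂ} {K : ℕ}
    (h : (a = -(K : ℂ) ∧ poch (a + b + 1) (2 * K) ≠ 0) ∨
      (c = -(K : ℂ) ∧ poch (a + b + 1) K ≠ 0))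
    (hcd : poch (c + d) (2 * K) ≠ 0) :
    pFq [2 * a, 2 * b + 1, c] [a + b + 1, c + d] 1
      = pFq [a, b + 1 / 2, c, d] [a + b + 1, (c + d) / 2, (c + d + 1) / 2] 1 := by
  have hα : ∀ k, K < k → poch a k = 0 ∨ ∀ m, k ≤ m → poch c m / poch (c + d) m = 0 := by
    intro k hk
    rcases h with ⟨rfl, -⟩ | ⟨rfl, -⟩
    · exact Or.inl (poch_neg_eq_zero hk)
    · exact Or.inr fun m hm => by rw [poch_neg_eq_zero (by omega), zero_div]
  have hα' : ∀ k, K < k → poch a k = 0 ∨ poch c k = 0 := by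
    intro k hk
    rcases h with ⟨rfl, -⟩ | ⟨rfl, -⟩
    · exact Or.inl (poch_neg_eq_zero hk)
    · exact Or.inr (poch_neg_eq_zero hk)
  -- The cut-off `2K` is kept even if `c = -K` stops the series at `K`: the moment of `(X(1-X))^k`
  -- involves all degrees up to `2k`.
  have hp : ∀ m, 2 * K < m → poch (2 * a) m = 0 ∨ poch c m = 0 := by
    intro m hm
    rcases h with ⟨rfl, -⟩ | ⟨rfl, -⟩
    · left
      rw [show 2 * -(K : ℂ) = -((2 * K : ℕ) : ℂ) by push_cast; ring]
      exact poch_neg_eq_zero hm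
    · exact Or.inr (poch_neg_eq_zero (by omega))
  -- If `c = -K`, then `(a+b+1)_m` may vanish for `m > K`, but the weight already vanishes there.
  have hs : ∀ m ≤ 2 * K, poch c m / poch (c + d) m ≠ 0 → poch (a + b + 1) m ≠ 0 := by
    intro m hm hw
    rcases h with ⟨-, h⟩ | ⟨rfl, h⟩
    · exact poch_ne_zero_of_le hm h
    · refine poch_ne_zero_of_le (not_lt.1 fun hlt => hw ?_) h
      rw [poch_neg_eq_zero hlt, zero_div]
  rw [pFq_three_two_eq_sum hp, pFq_four_three_eq_sum hα',
    sum_hypergeometric_transform (α := a) (β := b + 1 / 2) (K := K)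
      (P := fun k m => ((Polynomial.X * (1 - Polynomial.X) : Polynomial ℂ) ^ k).coeff m)
      (coeff_recurrence_pow a b)
      (fun k m hkm => by simpa using coeff_mul_X_mul_pow_of_lt 1 (1 - Polynomial.X) hkm)
      (by simp) (by omega) hs hα]
  refine sum_congr rfl fun k hk => ?_
  have hk' : k ≤ K := by simpa [Nat.lt_succ_iff] using hk
  have hne : poch (c + d) (2 * k) ≠ 0 := poch_ne_zero_of_le (by omega) hcd
  have hbeta := sum_coeff_mul_beta (c := c) (d := d) (T := 2 * K + 1) (i := k) (j := k) (by omega)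
    (by rwa [← two_mul])
  simp only [← mul_pow] at hbeta
  simp only [hbeta, ← two_mul]
  rw [poch_two_mul] at hne ⊢
  have h4 : (4 : ℂ) ^ k ≠ 0 := pow_ne_zero _ (by norm_num)
  have he := left_ne_zero_of_mul (right_ne_zero_of_mul hne)
  have hf := right_ne_zero_of_mul (right_ne_zero_of_mul hne)
  rw [mul_div_assoc (4 ^ k)]
  generalize poch a k * poch (b + 1 / 2) k / (poch (a + b + 1) k * (k.factorial : ℂ)) = r
  field_simp

/-- The quadratic transformation of a terminating `₃F₂` at `1` with a linear prefactor. -/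
theorem pFq_quadratic_linear {a b c d : ℂ} {K : ℕ}
    (h : (a + 1 / 2 = -(K : ℂ) ∧ poch (a + b + 1) (2 * K + 1) ≠ 0) ∨
      (c = -(K : ℂ) ∧ poch (a + b + 1) K ≠ 0))
    (hcd : poch (c + d) (2 * K + 1) ≠ 0) :
    pFq [2 * a, 2 * b + 1, c] [a + b + 1, c + d] 1
      = (d - c) / (d + c) *
        pFq [a + 1 / 2, b + 1, c, d] [a + b + 1, (c + d) / 2 + 1, (c + d + 1) / 2] 1 := by
  have hα : ∀ k, K < k →
      poch (a + 1 / 2) k = 0 ∨ ∀ m, k ≤ m → poch c m / poch (c + d) m = 0 := by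
    intro k hk
    rcases h with ⟨h, -⟩ | ⟨rfl, -⟩
    · exact Or.inl (h ▸ poch_neg_eq_zero hk)
    · exact Or.inr fun m hm => by rw [poch_neg_eq_zero (by omega), zero_div]
  have hα' : ∀ k, K < k → poch (a + 1 / 2) k = 0 ∨ poch c k = 0 := by
    intro k hk
    rcases h with ⟨h, -⟩ | ⟨rfl, -⟩
    · exact Or.inl (h ▸ poch_neg_eq_zero hk)
    · exact Or.inr (poch_neg_eq_zero hk)
  have hp : ∀ m, 2 * K + 1 < m → poch (2 * a) m = 0 ∨ poch c m = 0 := by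
    intro m hm
    rcases h with ⟨h, -⟩ | ⟨rfl, -⟩
    · left
      rw [show 2 * a = -((2 * K + 1 : ℕ) : ℂ) by push_cast; linear_combination 2 * h]
      exact poch_neg_eq_zero hm
    · exact Or.inr (poch_neg_eq_zero (by omega))
  have hs : ∀ m ≤ 2 * K + 1, poch c m / poch (c + d) m ≠ 0 → poch (a + b + 1) m ≠ 0 := by
    intro m hm hw
    rcases h with ⟨-, h⟩ | ⟨rfl, h⟩
    · exact poch_ne_zero_of_le hm h
    · refine poch_ne_zero_of_le (not_lt.1 fun hlt => hw ?_) h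
      rw [poch_neg_eq_zero hlt, zero_div]
  rw [pFq_three_two_eq_sum hp, pFq_four_three_eq_sum hα',
    sum_hypergeometric_transform (α := a + 1 / 2) (β := b + 1) (K := K)
      (P := fun k m => ((1 - 2 * Polynomial.X)
        * (Polynomial.X * (1 - Polynomial.X) : Polynomial ℂ) ^ k).coeff m)
      (coeff_recurrence_mul_pow a b)
      (fun k m hkm => coeff_mul_X_mul_pow_of_lt _ _ hkm)
      (by simp) (by omega) hs hα, mul_sum]
  refine sum_congr rfl fun k hk => ?_
  have hk' : k ≤ K := by simpa [Nat.lt_succ_iff] using hk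
  have hne : poch (c + d) (2 * k + 1) ≠ 0 := poch_ne_zero_of_le (by omega) hcd
  have hbeta := sum_coeff_mul_beta (c := c) (d := d) (T := 2 * K + 1 + 1) (i := k) (j := k + 1)
    (by omega) (by rwa [show k + (k + 1) = 2 * k + 1 by ring])
  have hbeta' := sum_coeff_mul_beta (c := c) (d := d) (T := 2 * K + 1 + 1) (i := k + 1) (j := k)
    (by omega) (by rwa [show k + 1 + k = 2 * k + 1 by ring])
  -- Writing `1 - 2X = (1-X) - X` gives two Beta moments, whose difference has the factor `(d+k) -
  -- (c+k) = d - c`, independent of `k`.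
  have hpoly : (1 - 2 * Polynomial.X) * (Polynomial.X * (1 - Polynomial.X) : Polynomial ℂ) ^ k
      = Polynomial.X ^ k * (1 - Polynomial.X) ^ (k + 1)
        - Polynomial.X ^ (k + 1) * (1 - Polynomial.X) ^ k := by
    rw [mul_pow]
    ring
  simp only [hpoly, Polynomial.coeff_sub, sub_mul, sum_sub_distrib, hbeta, hbeta']
  rw [show k + (k + 1) = 2 * k + 1 by ring, show k + 1 + k = 2 * k + 1 by ring,
    ← sub_div, poch_succ c, poch_succ d]
  rw [poch_two_mul_add_one] at hne ⊢
  have hcd0 : c + d ≠ 0 := left_ne_zero_of_mul hne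
  have h4 : (4 : ℂ) ^ k ≠ 0 := pow_ne_zero _ (by norm_num)
  have hdc0 : d + c ≠ 0 := by rwa [add_comm]
  have hef := right_ne_zero_of_mul (right_ne_zero_of_mul hne)
  have he := left_ne_zero_of_mul hef
  have hf := right_ne_zero_of_mul hef
  generalize poch ((c + d) / 2 + 1) k = e at *
  generalize poch ((c + d + 1) / 2) k = f at *
  rw [mul_div_assoc (4 ^ k)]
  generalize poch (a + 1 / 2) k * poch (b + 1) k / (poch (a + b + 1) k * (k.factorial : ℂ)) = r
  rw [add_comm d c]
  field_simp
  ring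

theorem pFq_three_two_swap (p q c s e : ℂ) : pFq [p, q, c] [s, e] 1 = pFq [q, p, c] [s, e] 1 := by
  simp only [pFq, List.map_cons, List.prod_cons, mul_left_comm]

theorem pFq_four_three_swap (α β c d s e f : ℂ) :
    pFq [α, β, c, d] [s, e, f] 1 = pFq [β, α, c, d] [s, e, f] 1 := by
  unfold pFq
  refine tsum_congr fun k => ?_
  simp only [List.map_cons, List.prod_cons]
  rw [mul_left_comm]

theorem pFq_quadratic_of_terminates {a b c d : ℂ}
    (h : (TerminatesThrough (2 * a) [a + b + 1, c + d] ∧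
          TerminatesThrough a [a + b + 1, (c + d) / 2, (c + d + 1) / 2]) ∨
        (TerminatesThrough (2 * b + 1) [a + b + 1, c + d] ∧
          TerminatesThrough (b + 1 / 2) [a + b + 1, (c + d) / 2, (c + d + 1) / 2]) ∨
        (TerminatesThrough c [a + b + 1, c + d] ∧
          TerminatesThrough c [a + b + 1, (c + d) / 2, (c + d + 1) / 2])) :
    pFq [2 * a, 2 * b + 1, c] [a + b + 1, c + d] 1
      = pFq [a, b + 1 / 2, c, d] [a + b + 1, (c + d) / 2, (c + d + 1) / 2] 1 := by
  rcases h with ⟨⟨N, hN, hl⟩, ⟨K, hK, -⟩⟩ | ⟨⟨N, hN, hl⟩, ⟨K, hK, -⟩⟩ | ⟨-, ⟨K, hK, hl⟩⟩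
  · obtain rfl : N = 2 * K := by
      have : (N : ℂ) = (2 * K : ℕ) := by push_cast; linear_combination hN - 2 * hK
      exact_mod_cast this
    exact pFq_quadratic (Or.inl ⟨hK, hl _ (by simp)⟩) (hl _ (by simp))
  · obtain rfl : N = 2 * K := by
      have : (N : ℂ) = (2 * K : ℕ) := by push_cast; linear_combination hN - 2 * hK
      exact_mod_cast this
    have hs : b + 1 / 2 + (a - 1 / 2) + 1 = a + b + 1 := by ring
    -- The substitution `(a, b) ↦ (b + 1/2, a - 1/2)` exchanges `2a` with `2b + 1` and `a` with `b +
    -- 1/2`, and fixes `a + b + 1`.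
    have := pFq_quadratic (a := b + 1 / 2) (b := a - 1 / 2) (c := c) (d := d)
      (Or.inl ⟨hK, by rw [hs]; exact hl _ (by simp)⟩) (hl _ (by simp))
    rwa [hs, show 2 * (b + 1 / 2) = 2 * b + 1 by ring, show 2 * (a - 1 / 2) + 1 = 2 * a by ring,
      show a - 1 / 2 + 1 / 2 = a by ring, pFq_three_two_swap, pFq_four_three_swap] at this
  -- Termination of the `₃F₂` through `c = -K` controls `(c+d)_m` only up to `K`; the lower
  -- parameters of the `₄F₃` give it up to `2K`.
  · refine pFq_quadratic (Or.inr ⟨hK, hl _ (by simp)⟩) ?_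
    rw [poch_two_mul]
    exact mul_ne_zero (pow_ne_zero _ (by norm_num)) (mul_ne_zero (hl _ (by simp)) (hl _ (by simp)))

theorem pFq_quadratic_linear_of_terminates {a b c d : ℂ} (hcd : c + d ≠ 0)
    (h : (TerminatesThrough (2 * a) [a + b + 1, c + d] ∧
          TerminatesThrough (a + 1 / 2) [a + b + 1, (c + d) / 2 + 1, (c + d + 1) / 2]) ∨
        (TerminatesThrough (2 * b + 1) [a + b + 1, c + d] ∧
          TerminatesThrough (b + 1) [a + b + 1, (c + d) / 2 + 1, (c + d + 1) / 2]) ∨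
        (TerminatesThrough c [a + b + 1, c + d] ∧
          TerminatesThrough c [a + b + 1, (c + d) / 2 + 1, (c + d + 1) / 2])) :
    pFq [2 * a, 2 * b + 1, c] [a + b + 1, c + d] 1
      = (d - c) / (d + c) *
        pFq [a + 1 / 2, b + 1, c, d] [a + b + 1, (c + d) / 2 + 1, (c + d + 1) / 2] 1 := by
  rcases h with ⟨⟨N, hN, hl⟩, ⟨K, hK, -⟩⟩ | ⟨⟨N, hN, hl⟩, ⟨K, hK, -⟩⟩ | ⟨-, ⟨K, hK, hl⟩⟩
  · obtain rfl : N = 2 * K + 1 := by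
      have : (N : ℂ) = (2 * K + 1 : ℕ) := by push_cast; linear_combination hN - 2 * hK
      exact_mod_cast this
    exact pFq_quadratic_linear (Or.inl ⟨hK, hl _ (by simp)⟩) (hl _ (by simp))
  · obtain rfl : N = 2 * K + 1 := by
      have : (N : ℂ) = (2 * K + 1 : ℕ) := by push_cast; linear_combination hN - 2 * hK
      exact_mod_cast this
    have hs : b + 1 / 2 + (a - 1 / 2) + 1 = a + b + 1 := by ring
    have := pFq_quadratic_linear (a := b + 1 / 2) (b := a - 1 / 2) (c := c) (d := d)
      (Or.inl ⟨by rw [← hK]; ring, by rw [hs]; exact hl _ (by simp)⟩) (hl _ (by simp))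
    rwa [hs, show 2 * (b + 1 / 2) = 2 * b + 1 by ring, show 2 * (a - 1 / 2) + 1 = 2 * a by ring,
      show a - 1 / 2 + 1 = a + 1 / 2 by ring, show b + 1 / 2 + 1 / 2 = b + 1 by ring,
      pFq_three_two_swap, pFq_four_three_swap] at this
  · refine pFq_quadratic_linear (Or.inr ⟨hK, hl _ (by simp)⟩) ?_
    rw [poch_two_mul_add_one]
    exact mul_ne_zero hcd
      (mul_ne_zero (pow_ne_zero _ (by norm_num)) (mul_ne_zero (hl _ (by simp)) (hl _ (by simp))))

/-! ### Continuous Hahn and Wilson polynomials. -/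

theorem pFq_three_two_lower_swap (p q c s e : ℂ) :
    pFq [p, q, c] [s, e] 1 = pFq [p, q, c] [e, s] 1 := by
  unfold pFq
  refine tsum_congr fun k => ?_
  simp only [List.map_cons, List.prod_cons]
  rw [mul_left_comm (poch s k)]

theorem pFq_four_three_lower_swap (α β c d s e f : ℂ) :
    pFq [α, β, c, d] [s, e, f] 1 = pFq [α, β, c, d] [s, f, e] 1 := by
  unfold pFq
  refine tsum_congr fun k => ?_
  simp only [List.map_cons, List.prod_cons]
  rw [mul_left_comm (poch e k)]

/-- At `x = ia` the parameter `a + ix` is zero, so only the term `k = 0` survives. A nonzero value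
therefore provides the nonvanishing Pochhammer symbols that `contHahn_eq` requires. -/
theorem contHahn_I_mul (n : ℕ) (a b c d : ℂ) :
    contHahn n (Complex.I * a) a b c d
      = Complex.I ^ n * poch (a + c) n * poch (a + d) n / (n.factorial : ℂ) := by
  unfold contHahn
  have h0 : a + Complex.I * (Complex.I * a) = 0 := by
    linear_combination a * Complex.I_mul_I
  rw [sum_range_succ', sum_eq_zero, h0]
  · simp [poch_zero_right]
    ring
  · intro k _
    simp [h0, poch_succ_left]

/-- The factor `j = 0` of the product is `a² - a² = 0`, so again only `k = 0` contributes. -/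
theorem wilson_neg_sq (n : ℕ) (a b c d : ℂ) :
    wilson n (-a ^ 2) a b c d = poch (a + b) n * poch (a + c) n * poch (a + d) n := by
  unfold wilson
  rw [sum_range_succ', sum_eq_zero]
  · simp [poch_zero_right]
  · intro k _
    simp [prod_range_succ']

/-- Even continuous Hahn polynomials are Wilson polynomials, up to normalization. -/
theorem contHahn_two_mul_div {a b : ℂ} {n : ℕ} (x : ℂ)
    (h : contHahn (2 * n) (Complex.I * a) a b a b ≠ 0) :
    wilson n (-a ^ 2) a b (1 / 2) 0 ≠ 0 ∧
    contHahn (2 * n) x a b a b / contHahn (2 * n) (Complex.I * a) a b a b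
      = wilson n (x ^ 2) a b (1 / 2) 0 / wilson n (-a ^ 2) a b (1 / 2) 0 := by
  have hpre := h
  rw [contHahn_I_mul] at hpre
  have h1 : poch (a + a) (2 * n) ≠ 0 := fun h0 => hpre (by simp [h0])
  have h2 : poch (a + b) (2 * n) ≠ 0 := fun h0 => hpre (by simp [h0])
  have h3 : poch (a + b) n ≠ 0 := poch_ne_zero_of_le (by omega) h2
  have h4 := h1
  rw [poch_two_mul, show (a + a) / 2 = a + 0 by ring, show (a + a + 1) / 2 = a + 1 / 2 by ring]
    at h4
  have h5 := left_ne_zero_of_mul (right_ne_zero_of_mul h4)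
  have h6 := right_ne_zero_of_mul (right_ne_zero_of_mul h4)
  have hw : wilson n (-a ^ 2) a b (1 / 2) 0 ≠ 0 := by
    rw [wilson_neg_sq]
    exact mul_ne_zero (mul_ne_zero h3 h6) h5
  refine ⟨hw, ?_⟩
  rw [div_eq_div_iff h hw, contHahn_I_mul, wilson_neg_sq, contHahn_eq _ _ _ _ _ _ h1 h2,
    wilson_eq _ _ _ _ _ _ h3 h6 h5]
  have hs : -(n : ℂ) + (n + a + b - 1) + 1 = a + b := by ring
  have hcd : a + Complex.I * x + (a - Complex.I * x) = a + a := by ring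
  -- These parameters solve `2a' = -2n` and `2b' + 1 = 2n + 2a + 2b - 1`; then `a' + b' + 1 = a + b`
  -- and `c + d = 2a` are exactly the lower parameters of the Hahn series.
  have key := pFq_quadratic (a := -(n : ℂ)) (b := n + a + b - 1) (c := a + Complex.I * x)
    (d := a - Complex.I * x) (K := n) (Or.inl ⟨rfl, by rwa [hs]⟩) (by rwa [hcd])
  rw [hs, hcd, pFq_three_two_lower_swap, pFq_four_three_lower_swap] at key
  rw [show -((2 * n : ℕ) : ℂ) = 2 * -(n : ℂ) by push_cast; ring,
    show ((2 * n : ℕ) : ℂ) + a + b + a + b - 1 = 2 * (n + a + b - 1) + 1 by push_cast; ring, key,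
    show (n : ℂ) + a + b + 1 / 2 + 0 - 1 = n + a + b - 1 + 1 / 2 by ring,
    show (a + a) / 2 = a + 0 by ring, show (a + a + 1) / 2 = a + 1 / 2 by ring]
  ring

/-- Odd continuous Hahn polynomials are `x` times Wilson polynomials, up to normalization. -/
theorem contHahn_two_mul_add_one_div {a b : ℂ} {n : ℕ} (x : ℂ)
    (h : contHahn (2 * n + 1) (Complex.I * a) a b a b ≠ 0) :
    Complex.I * a * wilson n (-a ^ 2) a b (1 / 2) 1 ≠ 0 ∧
    contHahn (2 * n + 1) x a b a b / contHahn (2 * n + 1) (Complex.I * a) a b a b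
      = x * wilson n (x ^ 2) a b (1 / 2) 1
        / (Complex.I * a * wilson n (-a ^ 2) a b (1 / 2) 1) := by
  have hpre := h
  rw [contHahn_I_mul] at hpre
  have h1 : poch (a + a) (2 * n + 1) ≠ 0 := fun h0 => hpre (by simp [h0])
  have h2 : poch (a + b) (2 * n + 1) ≠ 0 := fun h0 => hpre (by simp [h0])
  have h3 : poch (a + b) n ≠ 0 := poch_ne_zero_of_le (by omega) h2
  have h4 := h1
  rw [poch_two_mul_add_one, show (a + a) / 2 + 1 = a + 1 by ring,
    show (a + a + 1) / 2 = a + 1 / 2 by ring] at h4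
  have ha : a ≠ 0 := fun h0 => h4 (by simp [h0])
  have h5 := left_ne_zero_of_mul (right_ne_zero_of_mul (right_ne_zero_of_mul h4))
  have h6 := right_ne_zero_of_mul (right_ne_zero_of_mul (right_ne_zero_of_mul h4))
  have hw : Complex.I * a * wilson n (-a ^ 2) a b (1 / 2) 1 ≠ 0 := by
    rw [wilson_neg_sq]
    exact mul_ne_zero (mul_ne_zero Complex.I_ne_zero ha) (mul_ne_zero (mul_ne_zero h3 h6) h5)
  refine ⟨hw, ?_⟩
  rw [div_eq_div_iff h hw, contHahn_I_mul, wilson_neg_sq, contHahn_eq _ _ _ _ _ _ h1 h2,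
    wilson_eq _ _ _ _ _ _ h3 h6 h5]
  have hs : -(n : ℂ) - 1 / 2 + (n + a + b - 1 / 2) + 1 = a + b := by ring
  have hcd : a + Complex.I * x + (a - Complex.I * x) = a + a := by ring
  have key := pFq_quadratic_linear (a := -(n : ℂ) - 1 / 2) (b := n + a + b - 1 / 2)
    (c := a + Complex.I * x) (d := a - Complex.I * x) (K := n)
    (Or.inl ⟨by ring, by rwa [hs]⟩) (by rwa [hcd])
  rw [hs, hcd, pFq_three_two_lower_swap, pFq_four_three_lower_swap] at key
  -- The prefactor `(d - c)/(d + c)` equals `-ix/a = x/(ia)`, the linear factor that accompanies odd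
  -- degree.
  have hratio : (a - Complex.I * x - (a + Complex.I * x))
      / (a - Complex.I * x + (a + Complex.I * x)) * (Complex.I * a) = x := by
    rw [show a - Complex.I * x + (a + Complex.I * x) = 2 * a by ring]
    field_simp
    linear_combination -2 * x * Complex.I_sq
  rw [show -((2 * n + 1 : ℕ) : ℂ) = 2 * (-(n : ℂ) - 1 / 2) by push_cast; ring,
    show ((2 * n + 1 : ℕ) : ℂ) + a + b + a + b - 1 = 2 * (n + a + b - 1 / 2) + 1 by
      push_cast; ring, key,
    show (n : ℂ) + a + b + 1 / 2 + 1 - 1 = n + a + b - 1 / 2 + 1 by ring,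
    show -(n : ℂ) - 1 / 2 + 1 / 2 = -n by ring,
    show (a + a) / 2 + 1 = a + 1 by ring, show (a + a + 1) / 2 = a + 1 / 2 by ring]
  generalize (a - Complex.I * x - (a + Complex.I * x)) / (a - Complex.I * x + (a + Complex.I * x))
    = r at hratio
  generalize pFq _ _ 1 = F
  generalize Complex.I ^ (2 * n + 1) * poch (a + a) (2 * n + 1) * poch (a + b) (2 * n + 1)
    / ((2 * n + 1).factorial : ℂ) = t
  linear_combination
    (t * F * (poch (a + b) n * poch (a + 1 / 2) n * poch (a + 1) n)) * hratio

theorem mainTheorem10 :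
    -- continuous Hahn to Wilson, even and odd degree
    (∀ a b : ℂ, ((a.im = 0 ∧ b.im = 0) ∨ b = (starRingEnd ℂ) a) → ∀ (n : ℕ) (x : ℂ),
      (contHahn (2 * n) (Complex.I * a) a b a b ≠ 0 →
        wilson n (-a ^ 2) a b (1 / 2) 0 ≠ 0 ∧
        contHahn (2 * n) x a b a b / contHahn (2 * n) (Complex.I * a) a b a b
          = wilson n (x ^ 2) a b (1 / 2) 0 / wilson n (-a ^ 2) a b (1 / 2) 0) ∧
      (contHahn (2 * n + 1) (Complex.I * a) a b a b ≠ 0 →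
        Complex.I * a * wilson n (-a ^ 2) a b (1 / 2) 1 ≠ 0 ∧
        contHahn (2 * n + 1) x a b a b / contHahn (2 * n + 1) (Complex.I * a) a b a b
          = x * wilson n (x ^ 2) a b (1 / 2) 1
            / (Complex.I * a * wilson n (-a ^ 2) a b (1 / 2) 1))) ∧
    -- first terminating `₃F₂ = ₄F₃` identity
    (∀ a b c d : ℂ,
      ((TerminatesThrough (2 * a) [a + b + 1, c + d] ∧
          TerminatesThrough a [a + b + 1, (c + d) / 2, (c + d + 1) / 2]) ∨
        (TerminatesThrough (2 * b + 1) [a + b + 1, c + d] ∧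
          TerminatesThrough (b + 1 / 2) [a + b + 1, (c + d) / 2, (c + d + 1) / 2]) ∨
        (TerminatesThrough c [a + b + 1, c + d] ∧
          TerminatesThrough c [a + b + 1, (c + d) / 2, (c + d + 1) / 2])) →
      pFq [2 * a, 2 * b + 1, c] [a + b + 1, c + d] 1
        = pFq [a, b + 1 / 2, c, d] [a + b + 1, (c + d) / 2, (c + d + 1) / 2] 1) ∧
    -- second terminating `₃F₂ = ₄F₃` identity
    (∀ a b c d : ℂ, c + d ≠ 0 →
      ((TerminatesThrough (2 * a) [a + b + 1, c + d] ∧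
          TerminatesThrough (a + 1 / 2) [a + b + 1, (c + d) / 2 + 1, (c + d + 1) / 2]) ∨
        (TerminatesThrough (2 * b + 1) [a + b + 1, c + d] ∧
          TerminatesThrough (b + 1) [a + b + 1, (c + d) / 2 + 1, (c + d + 1) / 2]) ∨
        (TerminatesThrough c [a + b + 1, c + d] ∧
          TerminatesThrough c [a + b + 1, (c + d) / 2 + 1, (c + d + 1) / 2])) →
      pFq [2 * a, 2 * b + 1, c] [a + b + 1, c + d] 1
        = (d - c) / (d + c) *
          pFq [a + 1 / 2, b + 1, c, d] [a + b + 1, (c + d) / 2 + 1, (c + d + 1) / 2] 1) := by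
  exact ⟨fun a b _ n x => ⟨contHahn_two_mul_div x, contHahn_two_mul_add_one_div x⟩,
    fun a b c d h => pFq_quadratic_of_terminates h,
    fun a b c d hcd h => pFq_quadratic_linear_of_terminates hcd h⟩
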